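/- Let $d\ge 1$. For $\psi\in L^1(\mathbb R^d)\cap L^2(\mathbb R^d)$ and $f\in L^2(\mathbb R^d)$ put $U[\psi]f:=|f*\psi|$, and for a path $p=(\psi_1,\dots,\psi_N)$ of such functions put $U[p]f:=U[\psi_N]\cdots U[\psi_1]f$. Let $\chi\in L^1(\mathbb R^d)\cap L^2(\mathbb R^d)$ and let $\Psi=(\psi_i)_{i\in I}$ be a countably infinite family in $L^1(\mathbb R^d)\cap L^2(\mathbb R^d)$ such that $\chi$ and $\Psi$ together form a semi-discrete Parseval frame, i.e. $$\|f*\chi\|_2^2+\sum_{i\in I}\|f*\psi_i\|_2^2=\|f\|_2^2\qquad\text{for all } f\in L^2(\mathbb R^d).$$ For $N\in\mathbb N=\{1,2,\dots\}$ define the energy remainder $W_N(f):=\sum_{p\in\Psi^N}\|U[p]f\|_2^2$. For $A\in GL_d(\mathbb R)$ let $\sigma_{\min}(A)$ be its smallest singular value and $D_A^2f:=|\det A|^{1/2}f(A\,\cdot)$. Let $(A_m)_{m\in\mathbb N}$ be a sequence in $GL_d(\mathbb R)$ with $\lim_{m\to\infty}\sigma_{\min}(A_m)=\infty$, and suppose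 that $$\delta:=\inf_{f\in L^2(\mathbb R^d),\ \|f\|_2=1}\ \inf_{k\in\mathbb N}\ \limsup_{m\to\infty}W_k(D_{A_m}^2f)>0 .$$ Then for every $g\in L^2(\mathbb R^d)$ there is a constant $C_g>0$ such that for every nonincreasing sequence $E=(E_N)_{N\in\mathbb N}$ of positive real numbers with $E_N\to0$ there is $f_{g,E}\in L^2(\mathbb R^d)$ with a) $\|f_{g,E}\|_2^2\le C_g(1+E_1)$, b) $\|f_{g,E}-g\|_2^2\le C_g E_1$, c) $W_N(f_{g,E})\ge\frac{\|g\|_2^2}{8}\,\delta\,E_N$ for all $N\in\mathbb N$. Furthermore, for every such sequence $E$, the set $$Y_E:=\{f\in L^2(\mathbb R^d) : \text{there are } C>0,\ N_0\in\mathbb N \text{ with } W_N(f)\le C\,E_N \text{ for all } N\ge N_0\}$$ is a countable union of nowhere dense sets in $L^2(\mathbb R^d)$ (i.e. meagre), and its complement $L^2(\mathbb R^d)\setminus Y_E$ is dense in $L^2(\mathbb R^d)$. -/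

import Mathlib

open MeasureTheory Filter Topology
open scoped ENNReal

noncomputable section

/-- `ℝᵈ` with the Euclidean norm and Lebesgue measure. -/
abbrev Rd (d : ℕ) : Type := EuclideanSpace ℝ (Fin d)

/-- The Hilbert space `L²(ℝᵈ)` of (classes of) complex-valued square-integrable functions. -/
abbrev L2 (d : ℕ) : Type := Lp ℂ 2 (volume : Measure (Rd d))

/-- The convolution `f * ψ`, `(f * ψ)(x) = ∫ f(t) ψ(x - t) dt`. For `f, ψ ∈ L²` the integral
converges absolutely for every `x` and depends only on the a.e. classes of `f` and `ψ`. -/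
def conv {d : ℕ} (f ψ : Rd d → ℂ) : Rd d → ℂ :=
  convolution f ψ (ContinuousLinearMap.mul ℂ ℂ) volume

/-- The single step scattering propagator `U[ψ] f = |f * ψ|`. -/
def stepPropagator {d : ℕ} (ψ f : Rd d → ℂ) : Rd d → ℂ :=
  fun x => ((‖conv f ψ x‖ : ℝ) : ℂ)

/-- The scattering propagator `U[p] f = | ⋯ |f * ψ₁| ⋯ * ψ_N|` along a path `p = (ψ₁, …, ψ_N)`;
it is the identity along the empty path. -/
def scatteringPropagator {d : ℕ} : {N : ℕ} → (Fin N → (Rd d → ℂ)) → (Rd d → ℂ) → (Rd d → ℂ)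
  | 0, _, f => f
  | _ + 1, p, f => scatteringPropagator (Fin.tail p) (stepPropagator (p 0) f)

/-- The energy remainder `W_N(f) = ∑_{p ∈ Ψ^N} ‖U[p] f‖₂²` of the family of filters
`Ψ = (ψ i)_{i ∈ ι}`, as an unconditional sum in `[0, ∞]`. -/
def energyRemainder {d : ℕ} {ι : Type*} (ψ : ι → Rd d → ℂ) (N : ℕ) (f : Rd d → ℂ) : ℝ≥0∞ :=
  ∑' p : Fin N → ι, eLpNorm (scatteringPropagator (fun n => ψ (p n)) f) 2 volume ^ 2

/-- The standing assumption on the filters: `χ` and all `ψ i` lie in `L¹ ∩ L²`, and together they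
form a semi-discrete Parseval frame,
`‖f * χ‖₂² + ∑ i, ‖f * ψ i‖₂² = ‖f‖₂²` for all `f ∈ L²(ℝᵈ)`. -/
structure IsScatteringFilterBank {d : ℕ} {ι : Type*} (χ : Rd d → ℂ) (ψ : ι → Rd d → ℂ) :
    Prop where
  lowPass_memL1 : MemLp χ 1 volume
  lowPass_memL2 : MemLp χ 2 volume
  highPass_memL1 : ∀ i, MemLp (ψ i) 1 volume
  highPass_memL2 : ∀ i, MemLp (ψ i) 2 volume
  parseval : ∀ f : L2 d,
    eLpNorm (conv f χ) 2 volume ^ 2 + ∑' i, eLpNorm (conv f (ψ i)) 2 volume ^ 2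
      = eLpNorm f 2 volume ^ 2

/-- The `L²`-normalized dilation `D²_A f = |det A|^{1/2} f(A ·)`. -/
def dilation {d : ℕ} (A : GL (Fin d) ℝ) (f : Rd d → ℂ) : Rd d → ℂ :=
  fun x => ((Real.sqrt |(A : Matrix (Fin d) (Fin d) ℝ).det| : ℝ) : ℂ) *
    f (Matrix.toEuclideanLin (A : Matrix (Fin d) (Fin d) ℝ) x)

/-- The smallest singular value of a `d × d` matrix, `d ≥ 1`. (`LinearMap.singularValues` lists
the singular values in decreasing order, starting with index `0`.) -/
def sigmaMin {d : ℕ} (A : GL (Fin d) ℝ) : ℝ :=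
  (Matrix.toEuclideanLin (A : Matrix (Fin d) (Fin d) ℝ)).singularValues (d - 1)

/-- `δ = inf_{‖f‖₂ = 1} inf_{k ≥ 1} limsup_{m → ∞} W_k(D²_{A_m} f)`. -/
def dilationEnergyBound {d : ℕ} {ι : Type*} (ψ : ι → Rd d → ℂ) (A : ℕ+ → GL (Fin d) ℝ) : ℝ≥0∞ :=
  ⨅ f : {f : L2 d // ‖f‖ = 1}, ⨅ k : ℕ+,
    limsup (fun m : ℕ+ => energyRemainder ψ k (dilation (A m) (f : L2 d))) atTop

/-- A nonincreasing null sequence `(E_N)_{N ≥ 1}` of positive real numbers. -/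
structure IsNonincreasingNullSeq (E : ℕ+ → ℝ) : Prop where
  pos : ∀ N, 0 < E N
  antitone : Antitone E
  tendsto_zero : Tendsto E atTop (𝓝 0)

/-- `Y_E`, the set of all `f ∈ L²(ℝᵈ)` with `W_N(f) ∈ O(E_N)`. -/
def decaySet {d : ℕ} {ι : Type*} (ψ : ι → Rd d → ℂ) (E : ℕ+ → ℝ) : Set (L2 d) :=
  {f | ∃ C : ℝ, 0 < C ∧ ∃ N₀ : ℕ+, ∀ N : ℕ+, N₀ ≤ N →
    energyRemainder ψ N f ≤ ENNReal.ofReal (C * E N)}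

end

/-! The argument is a gliding hump. Write W_k for the energy after k layers. Only three facts about
the propagators are used: Bessel's inequality for the filters, positive homogeneity, and ‖U_i f -
U_i h‖ ≤ ‖T_i (f - h)‖.

They make W_k continuous and almost superadditive: up to a factor 1 + ε, W_k(f) + W_k(h) exceeds
W_k(f + h) by at most a constant times Σ_i min(‖T_i f‖², ‖T_i h‖²), for every k ≥ 1
(`iterEnergy_add_le`). If T_i h_m → 0 for each i, this overlap vanishes by dominated convergence,
uniformly in k. Dilates h_m of a fixed unit vector in L¹ ∩ L² have this property: their L¹ norms are
|det A_m|^{-1/2} times a constant, and Young's inequality applies. By the hypothesis on δ, for each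
K infinitely many of them still carry energy δ/2 at layer K.

Hence f = g + Σ_j γ 2^{-j} h_{m_j} with γ² = ‖g‖² E_1 is chosen recursively (`exists_slow_decay`).
The j-th hump keeps its energy up to a layer K_j with E_{K_j} ≤ E_1 4^{-(j+1)}, and so serves all N
with E_N in the j-th interval of ratio 4.

For the topological statement the construction is run with a small multiple of √E: this gives f near
g outside `decaySet`, which is a countable union of closed sets and therefore meagre. -/

/-! ### Abstract energies: continuity and approximate superadditivity. -/

/-- A family of nonlinear operators `U i` on a normed space which is controlled by a family of
linear operators `T i` with square-summable outputs, as `U i = |T i ·|` is in scattering theory. -/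
structure IsPropagatorFamily {ι H : Type*} [NormedAddCommGroup H] [NormedSpace ℝ H]
    (T : ι → H →ₗ[ℝ] H) (U : ι → H → H) : Prop where
  tsum_le : ∀ f, ∑' i, ‖T i f‖ₑ ^ 2 ≤ ‖f‖ₑ ^ 2
  map_smul : ∀ i (c : ℝ), 0 ≤ c → ∀ f, U i (c • f) = c • U i f
  enorm_sub_le : ∀ i f h, ‖U i f - U i h‖ₑ ≤ ‖T i (f - h)‖ₑ

/-- The energy that is left after `k` applications of the family `U`. -/
noncomputable def iterEnergy {ι H : Type*} [NormedAddCommGroup H] (U : ι → H → H) :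
    ℕ → H → ℝ≥0∞
  | 0, f => ‖f‖ₑ ^ 2
  | k + 1, f => ∑' i, iterEnergy U k (U i f)

theorem enorm_sq_le_of_pos {H : Type*} [NormedAddCommGroup H] {ε : ℝ} (hε : 0 < ε) (x y : H) :
    ‖x‖ₑ ^ 2 ≤ ENNReal.ofReal (1 + ε) * ‖y‖ₑ ^ 2
      + ENNReal.ofReal (1 + 1 / ε) * ‖x - y‖ₑ ^ 2 := by
  have key : ‖x‖ ^ 2 ≤ (1 + ε) * ‖y‖ ^ 2 + (1 + 1 / ε) * ‖x - y‖ ^ 2 := by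
    have h1 : ‖x‖ ≤ ‖y‖ + ‖x - y‖ := by
      simpa using norm_add_le y (x - y)
    have h2 : ‖x‖ ^ 2 ≤ (‖y‖ + ‖x - y‖) ^ 2 := pow_le_pow_left₀ (norm_nonneg _) h1 2
    have h3 : (1 + ε) * ‖y‖ ^ 2 + (1 + 1 / ε) * ‖x - y‖ ^ 2 - (‖y‖ + ‖x - y‖) ^ 2
        = (ε * ‖y‖ - ‖x - y‖) ^ 2 / ε := by
      field_simp
      ring
    have h4 : 0 ≤ (ε * ‖y‖ - ‖x - y‖) ^ 2 / ε := by positivity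
    linarith
  simp only [← ofReal_norm, ← ENNReal.ofReal_pow (norm_nonneg _)]
  rw [← ENNReal.ofReal_mul (by positivity), ← ENNReal.ofReal_mul (by positivity),
    ← ENNReal.ofReal_add (by positivity) (by positivity)]
  exact ENNReal.ofReal_le_ofReal key

namespace IsPropagatorFamily

variable {ι H : Type*} [NormedAddCommGroup H] [NormedSpace ℝ H]
  {T : ι → H →ₗ[ℝ] H} {U : ι → H → H}

theorem map_zero (hU : IsPropagatorFamily T U) (i : ι) : U i 0 = 0 := by
  simpa using hU.map_smul i 0 le_rfl 0

theorem enorm_le (hU : IsPropagatorFamily T U) (i : ι) (f : H) : ‖U i f‖ₑ ≤ ‖T i f‖ₑ := by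
  simpa [hU.map_zero] using hU.enorm_sub_le i f 0

theorem tsum_enorm_sq_le (hU : IsPropagatorFamily T U) (f : H) :
    ∑' i, ‖U i f‖ₑ ^ 2 ≤ ‖f‖ₑ ^ 2 :=
  (ENNReal.tsum_le_tsum fun i => pow_le_pow_left₀ zero_le (hU.enorm_le i f) 2).trans
    (hU.tsum_le f)

theorem iterEnergy_le (hU : IsPropagatorFamily T U) (k : ℕ) (f : H) :
    iterEnergy U k f ≤ ‖f‖ₑ ^ 2 := by
  induction k generalizing f with
  | zero => exact le_rfl
  | succ k ih => exact (ENNReal.tsum_le_tsum fun i => ih (U i f)).trans (hU.tsum_enorm_sq_le f)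

theorem iterEnergy_ne_top (hU : IsPropagatorFamily T U) (k : ℕ) (f : H) :
    iterEnergy U k f ≠ ∞ :=
  ne_top_of_le_ne_top (by simp) (hU.iterEnergy_le k f)

theorem iterEnergy_antitone (hU : IsPropagatorFamily T U) (f : H) :
    Antitone fun k => iterEnergy U k f := by
  refine antitone_nat_of_succ_le fun k => ?_
  induction k generalizing f with
  | zero => exact hU.tsum_enorm_sq_le f
  | succ k ih => exact ENNReal.tsum_le_tsum fun i => ih (U i f)

theorem iterEnergy_smul (hU : IsPropagatorFamily T U) (k : ℕ) {c : ℝ} (hc : 0 ≤ c) (f : H) :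
    iterEnergy U k (c • f) = ENNReal.ofReal (c ^ 2) * iterEnergy U k f := by
  induction k generalizing f with
  | zero =>
    simp only [iterEnergy, enorm_smul, mul_pow, Real.enorm_of_nonneg hc, ENNReal.ofReal_pow hc]
  | succ k ih => simp only [iterEnergy, hU.map_smul _ c hc, ih, ENNReal.tsum_mul_left]

/-- The constants do not deteriorate with `k`: each layer passes the same `ε` on, and Bessel's
inequality sums the errors ‖T_i (f - h)‖² back to at most ‖f - h‖². -/
theorem iterEnergy_le_add (hU : IsPropagatorFamily T U) {ε : ℝ} (hε : 0 < ε) (k : ℕ) (f h : H) :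
    iterEnergy U k f ≤ ENNReal.ofReal (1 + ε) * iterEnergy U k h
      + ENNReal.ofReal (1 + 1 / ε) * ‖f - h‖ₑ ^ 2 := by
  induction k generalizing f h with
  | zero => exact enorm_sq_le_of_pos hε f h
  | succ k ih =>
    calc iterEnergy U (k + 1) f
        ≤ ∑' i, (ENNReal.ofReal (1 + ε) * iterEnergy U k (U i h)
          + ENNReal.ofReal (1 + 1 / ε) * ‖T i (f - h)‖ₑ ^ 2) := by
          refine ENNReal.tsum_le_tsum fun i => (ih (U i f) (U i h)).trans ?_
          gcongr
          exact hU.enorm_sub_le i f h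
      _ ≤ _ := by
          rw [ENNReal.tsum_add, ENNReal.tsum_mul_left, ENNReal.tsum_mul_left]
          simp only [iterEnergy]
          gcongr
          exact hU.tsum_le _

/-- In each first-layer channel the vector with the smaller output is treated as a perturbation of
the other, so its output bounds both the perturbation error and its own energy. One layer is needed
to separate the channels, hence `k + 1`. -/
theorem iterEnergy_add_le (hU : IsPropagatorFamily T U) {ε : ℝ} (hε : 0 < ε) (k : ℕ) (f h : H) :
    iterEnergy U (k + 1) f + iterEnergy U (k + 1) h
      ≤ ENNReal.ofReal (1 + ε) * iterEnergy U (k + 1) (f + h)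
        + ENNReal.ofReal (2 + 1 / ε) * ∑' i, min (‖T i f‖ₑ ^ 2) (‖T i h‖ₑ ^ 2) := by
  simp only [iterEnergy]
  rw [← ENNReal.tsum_add, ← ENNReal.tsum_mul_left, ← ENNReal.tsum_mul_left, ← ENNReal.tsum_add]
  refine ENNReal.tsum_le_tsum fun i => ?_
  have key : ∀ x y : H, iterEnergy U k (U i x) + iterEnergy U k (U i y)
      ≤ ENNReal.ofReal (1 + ε) * iterEnergy U k (U i (x + y))
        + ENNReal.ofReal (2 + 1 / ε) * ‖T i y‖ₑ ^ 2 := by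
    intro x y
    have h1 := hU.iterEnergy_le_add hε k (U i x) (U i (x + y))
    have h2 : ‖U i x - U i (x + y)‖ₑ ≤ ‖T i y‖ₑ := by
      rw [← enorm_neg, neg_sub]
      simpa using hU.enorm_sub_le i (x + y) x
    have h3 : iterEnergy U k (U i y) ≤ ‖T i y‖ₑ ^ 2 :=
      (hU.iterEnergy_le k _).trans (pow_le_pow_left₀ zero_le (hU.enorm_le i y) 2)
    calc _ ≤ (ENNReal.ofReal (1 + ε) * iterEnergy U k (U i (x + y))
            + ENNReal.ofReal (1 + 1 / ε) * ‖T i y‖ₑ ^ 2) + ‖T i y‖ₑ ^ 2 := by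
          refine add_le_add (h1.trans ?_) h3
          gcongr
      _ = _ := by
          rw [show (2 : ℝ) + 1 / ε = (1 + 1 / ε) + 1 by ring,
            ENNReal.ofReal_add (by positivity) zero_le_one, ENNReal.ofReal_one, add_mul, one_mul,
            add_assoc]
  rcases le_total (‖T i f‖ₑ ^ 2) (‖T i h‖ₑ ^ 2) with hle | hle
  · rw [min_eq_left hle, add_comm, add_comm f h]
    exact key h f
  · rw [min_eq_right hle]
    exact key f h

theorem toReal_iterEnergy_le (hU : IsPropagatorFamily T U) (k : ℕ) (f : H) :
    (iterEnergy U k f).toReal ≤ ‖f‖ ^ 2 := by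
  have := ENNReal.toReal_mono (by simp) (hU.iterEnergy_le k f)
  simpa using this

theorem toReal_iterEnergy_le_add (hU : IsPropagatorFamily T U) (k : ℕ) (f h : H) :
    (iterEnergy U k f).toReal ≤ (iterEnergy U k h).toReal
      + ‖f - h‖ * (‖h‖ ^ 2 + ‖f - h‖ + 1) := by
  -- For `f ≠ h` the choice ε = ‖f - h‖ makes both error terms vanish as `f` tends to `h`.
  rcases eq_or_ne f h with rfl | hne
  · simp
  have hε : 0 < ‖f - h‖ := norm_pos_iff.2 (sub_ne_zero.2 hne)
  have h1 := ENNReal.toReal_mono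
    (ENNReal.add_ne_top.2 ⟨ENNReal.mul_ne_top ENNReal.ofReal_ne_top (hU.iterEnergy_ne_top k h),
      ENNReal.mul_ne_top ENNReal.ofReal_ne_top (by simp)⟩) (hU.iterEnergy_le_add hε k f h)
  rw [ENNReal.toReal_add (ENNReal.mul_ne_top ENNReal.ofReal_ne_top (hU.iterEnergy_ne_top k h))
      (ENNReal.mul_ne_top ENNReal.ofReal_ne_top (by simp)), ENNReal.toReal_mul,
    ENNReal.toReal_mul, ENNReal.toReal_ofReal (by positivity),
    ENNReal.toReal_ofReal (by positivity), ENNReal.toReal_pow, toReal_enorm] at h1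
  have h2 := hU.toReal_iterEnergy_le k h
  have h3 : (1 + 1 / ‖f - h‖) * ‖f - h‖ ^ 2 = ‖f - h‖ ^ 2 + ‖f - h‖ := by
    field_simp
  rw [h3] at h1
  nlinarith [mul_le_mul_of_nonneg_left h2 hε.le]

theorem continuous_toReal_iterEnergy (hU : IsPropagatorFamily T U) (k : ℕ) :
    Continuous fun f => (iterEnergy U k f).toReal := by
  refine continuous_iff_continuousAt.2 fun h => ?_
  have hup : Continuous fun f : H => (iterEnergy U k h).toReal
      + ‖f - h‖ * (‖h‖ ^ 2 + ‖f - h‖ + 1) := by fun_prop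
  have hlo : Continuous fun f : H => (iterEnergy U k h).toReal
      - ‖h - f‖ * (‖f‖ ^ 2 + ‖h - f‖ + 1) := by fun_prop
  refine tendsto_of_tendsto_of_tendsto_of_le_of_le
    (by simpa using hlo.tendsto h) (by simpa using hup.tendsto h) (fun f => ?_) fun f =>
      hU.toReal_iterEnergy_le_add k f h
  have := hU.toReal_iterEnergy_le_add k h f
  simp only
  linarith

/-- Dominated convergence with the summable majorant ‖T_i f‖²; only channelwise convergence of `T i
(h m)` is required. -/
theorem tendsto_tsum_min (hU : IsPropagatorFamily T U) (f : H) {α : Type*} {l : Filter α}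
    {h : α → H} (hT : ∀ i, Tendsto (fun m => T i (h m)) l (𝓝 0)) :
    Tendsto (fun m => (∑' i, min (‖T i f‖ₑ ^ 2) (‖T i (h m)‖ₑ ^ 2)).toReal) l (𝓝 0) := by
  have hfin : ∑' i, ‖T i f‖ₑ ^ 2 ≠ ∞ := ne_top_of_le_ne_top (by simp) (hU.tsum_le f)
  have hterm : ∀ i, ‖T i f‖ₑ ^ 2 ≠ ∞ := fun i => by simp
  have hsum : Summable fun i => ‖T i f‖ ^ 2 := by
    simpa using ENNReal.summable_toReal hfin
  have heq : ∀ m, (∑' i, min (‖T i f‖ₑ ^ 2) (‖T i (h m)‖ₑ ^ 2)).toReal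
      = ∑' i, min (‖T i f‖ ^ 2) (‖T i (h m)‖ ^ 2) := by
    intro m
    rw [ENNReal.tsum_toReal_eq fun i => ne_top_of_le_ne_top (hterm i) (min_le_left _ _)]
    refine tsum_congr fun i => ?_
    rw [ENNReal.toReal_min (by simp) (by simp)]
    simp
  simp only [heq]
  rw [← tsum_zero (α := ℝ) (β := ι)]
  refine tendsto_tsum_of_dominated_convergence hsum (fun i => ?_)
    (Eventually.of_forall fun m i => ?_)
  · have h1 : Tendsto (fun m => ‖T i (h m)‖ ^ 2) l (𝓝 0) := by
      simpa using ((hT i).norm).pow 2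
    have h2 := (tendsto_const_nhds (x := ‖T i f‖ ^ 2) (f := l)).min h1
    rwa [min_eq_right (by positivity)] at h2
  · rw [Real.norm_of_nonneg (by positivity)]
    exact min_le_left _ _

/-- The overlap involves the first layer only, so one `m` works for all depths `k` at once. -/
theorem eventually_toReal_iterEnergy_add_le (hU : IsPropagatorFamily T U) (f : H) {α : Type*}
    {l : Filter α} {h : α → H} (hT : ∀ i, Tendsto (fun m => T i (h m)) l (𝓝 0)) {R : ℝ}
    (hR : ∀ m, ‖h m‖ ≤ R) {η : ℝ} (hη : 0 < η) :
    ∀ᶠ m in l, ∀ k : ℕ, (iterEnergy U (k + 1) f).toReal + (iterEnergy U (k + 1) (h m)).toReal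
      ≤ (iterEnergy U (k + 1) (f + h m)).toReal + η := by
  -- `B` bounds the energy of `f + h m`; the factor 1 + ε then costs at most ε B = η / 2, and the
  -- overlap gets the other half.
  set B : ℝ := (‖f‖ + R) ^ 2 + 1 with hB
  have hBpos : 0 < B := by positivity
  set ε : ℝ := η / (2 * B) with hεdef
  have hε : 0 < ε := by positivity
  have hlim := (hU.tendsto_tsum_min f hT).const_mul (2 + 1 / ε)
  rw [mul_zero] at hlim
  filter_upwards [hlim.eventually (gt_mem_nhds (half_pos hη))] with m hm k
  set s := ∑' i, min (‖T i f‖ₑ ^ 2) (‖T i (h m)‖ₑ ^ 2) with hs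
  have hsfin : s ≠ ∞ := ne_top_of_le_ne_top (b := ‖f‖ₑ ^ 2) (by simp)
    ((ENNReal.tsum_le_tsum fun i => min_le_left _ _).trans (hU.tsum_le f))
  have hW := hU.iterEnergy_ne_top (k + 1)
  have h1 := ENNReal.toReal_mono
    (ENNReal.add_ne_top.2 ⟨ENNReal.mul_ne_top ENNReal.ofReal_ne_top (hW (f + h m)),
      ENNReal.mul_ne_top ENNReal.ofReal_ne_top hsfin⟩) (hU.iterEnergy_add_le hε k f (h m))
  rw [ENNReal.toReal_add (hW _) (hW _), ENNReal.toReal_add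
      (ENNReal.mul_ne_top ENNReal.ofReal_ne_top (hW _))
      (ENNReal.mul_ne_top ENNReal.ofReal_ne_top hsfin), ENNReal.toReal_mul,
    ENNReal.toReal_mul, ENNReal.toReal_ofReal (by positivity),
    ENNReal.toReal_ofReal (by positivity)] at h1
  have h2 : (iterEnergy U (k + 1) (f + h m)).toReal ≤ B := by
    refine (hU.toReal_iterEnergy_le _ _).trans ?_
    have : ‖f + h m‖ ≤ ‖f‖ + R := (norm_add_le _ _).trans (by gcongr; exact hR m)
    have := pow_le_pow_left₀ (norm_nonneg _) this 2
    linarith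
  have h3 : ε * B = η / 2 := by rw [hεdef]; field_simp
  have h4 := mul_le_mul_of_nonneg_left h2 hε.le
  linarith

end IsPropagatorFamily

/-! ### The gliding hump. -/

theorem IsNonincreasingNullSeq.exists_dyadic {E : ℕ+ → ℝ} (hE : IsNonincreasingNullSeq E)
    (N : ℕ+) : ∃ j : ℕ, E N ≤ E 1 * (1 / 4) ^ j ∧ E 1 * (1 / 4) ^ (j + 1) < E N := by
  have hex : ∃ n : ℕ, E 1 * (1 / 4) ^ (n + 1) < E N := by
    have h : Tendsto (fun n : ℕ => E 1 * (1 / 4 : ℝ) ^ (n + 1)) atTop (𝓝 0) := by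
      have := (tendsto_pow_atTop_nhds_zero_of_lt_one (r := (1 / 4 : ℝ)) (by norm_num)
        (by norm_num)).comp (tendsto_add_atTop_nat 1)
      simpa using this.const_mul (E 1)
    exact (h.eventually (gt_mem_nhds (hE.pos N))).exists
  classical
  refine ⟨Nat.find hex, ?_, Nat.find_spec hex⟩
  rcases hj : Nat.find hex with _ | j
  · simpa using hE.antitone one_le
  · exact not_lt.1 (Nat.find_min hex (by omega))

namespace IsPropagatorFamily

variable {ι H : Type*} [NormedAddCommGroup H] [NormedSpace ℝ H]
  {T : ι → H →ₗ[ℝ] H} {U : ι → H → H}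

theorem exists_add_smul (hU : IsPropagatorFamily T U) {α : Type*} {l : Filter α} {h : α → H}
    (hT : ∀ i, Tendsto (fun m => T i (h m)) l (𝓝 0)) (hle : ∀ m, ‖h m‖ ≤ 1) {δ : ℝ}
    (hfreq : ∀ k : ℕ+, ∃ᶠ m in l, δ ≤ (iterEnergy U k (h m)).toReal) (f : H) {c : ℝ} (hc : 0 ≤ c)
    (K : ℕ+) {η : ℝ} (hη : 0 < η) :
    ∃ m, δ ≤ (iterEnergy U K (h m)).toReal ∧
      ∀ k : ℕ+, (iterEnergy U k f).toReal + c ^ 2 * (iterEnergy U k (h m)).toReal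
        ≤ (iterEnergy U k (f + c • h m)).toReal + η := by
  have hT' : ∀ i, Tendsto (fun m => T i (c • h m)) l (𝓝 0) := fun i => by
    simpa using (hT i).const_smul c
  have hle' : ∀ m, ‖c • h m‖ ≤ c := fun m => by
    rw [norm_smul, Real.norm_of_nonneg hc]
    exact mul_le_of_le_one_right hc (hle m)
  obtain ⟨m, hm, hadd⟩ := ((hfreq K).and_eventually
    (hU.eventually_toReal_iterEnergy_add_le f hT' hle' hη)).exists
  refine ⟨m, hm, fun k => ?_⟩
  have := hadd k.natPred
  rw [PNat.natPred_add_one, hU.iterEnergy_smul _ hc, ENNReal.toReal_mul,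
    ENNReal.toReal_ofReal (sq_nonneg c)] at this
  exact this

/-- The gliding hump construction of vectors whose energy decays slowly. -/
theorem exists_slow_decay [CompleteSpace H] (hU : IsPropagatorFamily T U) {α : Type*}
    {l : Filter α} {h : α → H} (hT : ∀ i, Tendsto (fun m => T i (h m)) l (𝓝 0))
    (hle : ∀ m, ‖h m‖ ≤ 1) {δ : ℝ} (hδ : 0 < δ)
    (hfreq : ∀ k : ℕ+, ∃ᶠ m in l, δ ≤ (iterEnergy U k (h m)).toReal) (g : H) {E : ℕ+ → ℝ}
    (hE : IsNonincreasingNullSeq E) :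
    ∃ f : H, ‖f - g‖ ^ 2 ≤ 4 * ‖g‖ ^ 2 * E 1 ∧
      ∀ N : ℕ+, ‖g‖ ^ 2 * (δ / 2) * E N ≤ (iterEnergy U N f).toReal := by
  rcases eq_or_ne g 0 with rfl | hg
  · exact ⟨0, by simp, fun N => by simp⟩
  have hE1 : 0 < E 1 := hE.pos 1
  obtain ⟨γ, hγ, hγ2⟩ : ∃ γ : ℝ, 0 < γ ∧ γ ^ 2 = ‖g‖ ^ 2 * E 1 :=
    ⟨√(‖g‖ ^ 2 * E 1), by positivity, Real.sq_sqrt (by positivity)⟩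
  set e : ℝ := γ ^ 2 * (δ / 2) with he
  have hKex : ∀ j : ℕ, ∃ K : ℕ+, E K ≤ E 1 * (1 / 4) ^ (j + 1) := fun j =>
    ((hE.tendsto_zero.eventually (gt_mem_nhds (by positivity))).exists).imp fun _ => le_of_lt
  choose K hK using hKex
  -- The hump index depends on the partial sum `x` built so far. The losses (3/4) e 4^{-n} over n ≥
  -- j add up to e 4^{-j}, half of the energy γ² 4^{-j} δ of the j-th hump.
  choose M hM hadd using fun (j : ℕ) (x : H) => hU.exists_add_smul hT hle hfreq x
    (c := γ * (1 / 2) ^ j) (by positivity) (K j) (η := 3 / 4 * e * (1 / 4) ^ j) (by positivity)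
  let F : ℕ → H := fun n => Nat.rec g (fun j x => x + (γ * (1 / 2) ^ j) • h (M j x)) n
  have hF : ∀ n, F (n + 1) = F n + (γ * (1 / 2) ^ n) • h (M n (F n)) := fun _ => rfl
  have hdist : ∀ n, dist (F n) (F (n + 1)) ≤ γ * (1 / 2) ^ n := fun n => by
    rw [hF, dist_self_add_right, norm_smul, Real.norm_of_nonneg (by positivity)]
    exact mul_le_of_le_one_right (by positivity) (hle _)
  obtain ⟨f, hf⟩ := cauchySeq_tendsto_of_complete
    (cauchySeq_of_le_geometric (1 / 2) γ (by norm_num) hdist)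
  refine ⟨f, ?_, fun N => ?_⟩
  · have h1 := dist_le_of_le_geometric_of_tendsto₀ (1 / 2) γ (by norm_num) hdist hf
    have h2 : ‖f - g‖ ≤ 2 * γ := by
      rw [← dist_eq_norm, dist_comm]
      calc dist g f ≤ γ / (1 - 1 / 2) := h1
        _ = 2 * γ := by ring
    calc ‖f - g‖ ^ 2 ≤ (2 * γ) ^ 2 := pow_le_pow_left₀ (norm_nonneg _) h2 2
      _ = 4 * ‖g‖ ^ 2 * E 1 := by rw [mul_pow, hγ2]; ring
  · obtain ⟨j, hj1, hj2⟩ := hE.exists_dyadic N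
    have hNK : N ≤ K j := by
      by_contra hlt
      exact absurd (hE.antitone (not_le.1 hlt).le) (not_le.2 ((hK j).trans_lt hj2))
    have hquarter : ∀ n : ℕ, (γ * (1 / 2 : ℝ) ^ n) ^ 2 = γ ^ 2 * (1 / 4) ^ n := fun n => by
      rw [mul_pow, ← pow_mul, mul_comm n, pow_mul]
      norm_num
    -- The j-th hump supplies γ² 4^{-j} δ. The losses telescope, since (3/4) 4^{-n} = 4^{-n} -
    -- 4^{-(n+1)}; later humps can only add energy apart from these losses.
    have hlow : ∀ n, j + 1 ≤ n →
        γ ^ 2 * (1 / 4) ^ j * δ - e * (1 / 4) ^ j + e * (1 / 4) ^ n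
          ≤ (iterEnergy U N (F n)).toReal := by
      intro n hn
      induction n, hn using Nat.le_induction with
      | base =>
        have h1 := hadd j (F j) N
        rw [← hF, hquarter] at h1
        have h2 : δ ≤ (iterEnergy U N (h (M j (F j)))).toReal := (hM j (F j)).trans
          (ENNReal.toReal_mono (hU.iterEnergy_ne_top _ _)
            (hU.iterEnergy_antitone _ (PNat.coe_le_coe _ _ |>.2 hNK)))
        have h3 : 0 ≤ (iterEnergy U N (F j)).toReal := ENNReal.toReal_nonneg
        have h4 := mul_le_mul_of_nonneg_left h2
          (show 0 ≤ γ ^ 2 * (1 / 4 : ℝ) ^ j by positivity)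
        rw [pow_succ (1 / 4 : ℝ)]
        linarith
      | succ n _ ih =>
        have h1 := hadd n (F n) N
        rw [← hF] at h1
        have h3 : 0 ≤ (γ * (1 / 2 : ℝ) ^ n) ^ 2 * (iterEnergy U N (h (M n (F n)))).toReal := by
          positivity
        rw [pow_succ (1 / 4 : ℝ)]
        linarith
    have hlim := ((hU.continuous_toReal_iterEnergy N).tendsto f).comp hf
    have hfin : γ ^ 2 * (1 / 4) ^ j * (δ / 2) ≤ (iterEnergy U N f).toReal := by
      refine ge_of_tendsto hlim ((eventually_ge_atTop (j + 1)).mono fun n hn => ?_)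
      refine le_trans ?_ (hlow n hn)
      have : 0 ≤ e * (1 / 4 : ℝ) ^ n := by positivity
      rw [he] at this ⊢
      linarith
    refine le_trans ?_ hfin
    rw [hγ2]
    have := mul_le_mul_of_nonneg_left hj1 (show 0 ≤ ‖g‖ ^ 2 * (δ / 2) by positivity)
    linarith

end IsPropagatorFamily

/-! ### Convolution, the energy recursion and the operators on L². -/

section Scattering

variable {d : ℕ} {ι : Type*}

theorem eLpNorm_two_sq {α F : Type*} [MeasurableSpace α] {μ : Measure α} [NormedAddCommGroup F]
    (f : α → F) : eLpNorm f 2 μ ^ 2 = ∫⁻ x, ‖f x‖ₑ ^ 2 ∂μ := by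
  simpa only [NNReal.coe_ofNat, ENNReal.coe_ofNat, ENNReal.rpow_ofNat] using
    eLpNorm_nnreal_pow_eq_lintegral (μ := μ) (f := f) (p := 2) two_ne_zero

theorem conv_congr {f f' ψ ψ' : Rd d → ℂ} (hf : f =ᵐ[volume] f') (hψ : ψ =ᵐ[volume] ψ') :
    conv f ψ = conv f' ψ' :=
  convolution_congr _ hf hψ

theorem convolutionExists_of_memLp_two {f ψ : Rd d → ℂ} (hf : MemLp f 2 volume)
    (hψ : MemLp ψ 2 volume) :
    ConvolutionExists f ψ (ContinuousLinearMap.mul ℂ ℂ) volume := fun x =>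
  hf.integrable_mul (hψ.comp_measurePreserving (Measure.measurePreserving_sub_left volume x))

theorem conv_add {f g ψ : Rd d → ℂ} (hf : MemLp f 2 volume) (hg : MemLp g 2 volume)
    (hψ : MemLp ψ 2 volume) : conv (f + g) ψ = conv f ψ + conv g ψ :=
  (convolutionExists_of_memLp_two hf hψ).add_distrib (convolutionExists_of_memLp_two hg hψ)

theorem conv_smul (c : ℝ) (f ψ : Rd d → ℂ) : conv (c • f) ψ = c • conv f ψ := by
  ext x
  simp only [conv, convolution, Pi.smul_apply, ContinuousLinearMap.mul_apply', smul_mul_assoc,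
    integral_smul]

theorem aestronglyMeasurable_conv {f ψ : Rd d → ℂ} (hf : AEStronglyMeasurable f volume)
    (hψ : AEStronglyMeasurable ψ volume) : AEStronglyMeasurable (conv f ψ) volume :=
  (hf.convolution_integrand _ hψ).integral_prod_right'

theorem energyRemainder_succ (ψ : ι → Rd d → ℂ) (k : ℕ) (f : Rd d → ℂ) :
    energyRemainder ψ (k + 1) f = ∑' i, energyRemainder ψ k (stepPropagator (ψ i) f) := by
  unfold energyRemainder
  rw [← (Fin.consEquiv fun _ : Fin (k + 1) => ι).tsum_eq, ENNReal.tsum_prod']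
  rfl

theorem energyRemainder_congr (ψ : ι → Rd d → ℂ) (k : ℕ) {f g : Rd d → ℂ}
    (hfg : f =ᵐ[volume] g) : energyRemainder ψ k f = energyRemainder ψ k g := by
  unfold energyRemainder
  refine tsum_congr fun p => ?_
  cases k with
  | zero => exact congrArg (· ^ 2) (eLpNorm_congr_ae hfg)
  | succ k =>
    -- After one convolution the two functions agree everywhere, not just almost everywhere.
    have : ∀ φ, stepPropagator φ f = stepPropagator φ g := fun φ => by
      unfold stepPropagator
      rw [conv_congr hfg EventuallyEq.rfl]
    simp only [scatteringPropagator, this]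

namespace IsScatteringFilterBank

variable {χ : Rd d → ℂ} {ψ : ι → Rd d → ℂ}

theorem tsum_eLpNorm_conv_le (hF : IsScatteringFilterBank χ ψ) (f : L2 d) :
    ∑' i, eLpNorm (conv f (ψ i)) 2 volume ^ 2 ≤ eLpNorm f 2 volume ^ 2 :=
  hF.parseval f ▸ le_add_self

theorem memLp_conv (hF : IsScatteringFilterBank χ ψ) (i : ι) (f : L2 d) :
    MemLp (conv f (ψ i)) 2 volume := by
  refine ⟨aestronglyMeasurable_conv (Lp.memLp f).1 (hF.highPass_memL2 i).1, ?_⟩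
  have h : eLpNorm (conv f (ψ i)) 2 volume ^ 2 < ∞ :=
    ((ENNReal.le_tsum i).trans (hF.tsum_eLpNorm_conv_le f)).trans_lt
      (ENNReal.pow_lt_top (Lp.memLp f).2)
  exact (ENNReal.pow_lt_top_iff.1 h).resolve_right two_ne_zero

theorem memLp_stepPropagator (hF : IsScatteringFilterBank χ ψ) (i : ι) (f : L2 d) :
    MemLp (stepPropagator (ψ i) f) 2 volume :=
  (hF.memLp_conv i f).norm.ofReal

/-- Convolution with the filter `ψ i` as a linear operator on `L²(ℝᵈ)`. -/
noncomputable def convLM (hF : IsScatteringFilterBank χ ψ) (i : ι) : L2 d →ₗ[ℝ] L2 d where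
  toFun f := (hF.memLp_conv i f).toLp
  map_add' f g := by
    rw [← MemLp.toLp_add]
    congr 1
    rw [← conv_add (Lp.memLp f) (Lp.memLp g) (hF.highPass_memL2 i)]
    exact conv_congr (Lp.coeFn_add f g) EventuallyEq.rfl
  map_smul' c f := by
    rw [RingHom.id_apply, ← MemLp.toLp_const_smul]
    congr 1
    rw [← conv_smul]
    exact conv_congr (Lp.coeFn_smul c f) EventuallyEq.rfl

/-- The propagator `f ↦ |f * ψ i|` as an operator on `L²(ℝᵈ)`. -/
noncomputable def propagator (hF : IsScatteringFilterBank χ ψ) (i : ι) (f : L2 d) : L2 d :=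
  (hF.memLp_stepPropagator i f).toLp

end IsScatteringFilterBank

/-! ### Young's inequality and the norms of dilates. -/

/-- Young's inequality `‖f * ψ‖₂ ≤ ‖f‖₁ ‖ψ‖₂` for measurable functions. -/
theorem eLpNorm_conv_sq_le_of_measurable {f ψ : Rd d → ℂ} (hf : Measurable f)
    (hψ : Measurable ψ) :
    eLpNorm (conv f ψ) 2 volume ^ 2 ≤ eLpNorm f 1 volume ^ 2 * eLpNorm ψ 2 volume ^ 2 := by
  have hfe : Measurable fun t => ‖f t‖ₑ := hf.enorm
  have hpt : ∀ x, ‖conv f ψ x‖ₑ ^ 2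
      ≤ (∫⁻ t, ‖f t‖ₑ) * ∫⁻ t, ‖f t‖ₑ * ‖ψ (x - t)‖ₑ ^ 2 := by
    intro x
    have hψx : Measurable fun t => ‖ψ (x - t)‖ₑ := (hψ.comp (measurable_id.const_sub x)).enorm
    have h1 : ‖conv f ψ x‖ₑ ≤ ∫⁻ t, ‖f t‖ₑ * ‖ψ (x - t)‖ₑ := by
      refine (enorm_integral_le_lintegral_enorm _).trans_eq (lintegral_congr fun t => ?_)
      simp [enorm_mul]
    -- Cauchy–Schwarz for the splitting |f||ψ| = |f|^{1/2} · (|f||ψ|²)^{1/2}.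
    have h2 := ENNReal.lintegral_mul_norm_pow_le (μ := volume) hfe.aemeasurable
      (hfe.mul (hψx.pow_const 2)).aemeasurable (p := 1 / 2) (q := 1 / 2) (by norm_num)
      (by norm_num) (by norm_num)
    have h3 : ∀ t, ‖f t‖ₑ ^ (1 / 2 : ℝ) * (‖f t‖ₑ * ‖ψ (x - t)‖ₑ ^ 2) ^ (1 / 2 : ℝ)
        = ‖f t‖ₑ * ‖ψ (x - t)‖ₑ := by
      intro t
      rw [ENNReal.mul_rpow_of_nonneg _ _ (by norm_num), ← mul_assoc,
        ← ENNReal.rpow_add_of_nonneg _ _ (by norm_num) (by norm_num), ← ENNReal.rpow_natCast,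
        ← ENNReal.rpow_mul]
      norm_num
    simp only [Pi.mul_apply, h3] at h2
    refine (pow_le_pow_left₀ zero_le (h1.trans h2) 2).trans_eq ?_
    rw [mul_pow, ← ENNReal.rpow_natCast, ← ENNReal.rpow_natCast, ← ENNReal.rpow_mul,
      ← ENNReal.rpow_mul]
    norm_num
  rw [eLpNorm_two_sq, eLpNorm_two_sq, eLpNorm_one_eq_lintegral_enorm]
  have hm : Measurable fun p : Rd d × Rd d => ‖f p.2‖ₑ * ‖ψ (p.1 - p.2)‖ₑ ^ 2 :=
    (hfe.comp measurable_snd).mul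
      ((hψ.comp (measurable_fst.sub measurable_snd)).enorm.pow_const 2)
  calc ∫⁻ x, ‖conv f ψ x‖ₑ ^ 2
      ≤ ∫⁻ x, (∫⁻ t, ‖f t‖ₑ) * ∫⁻ t, ‖f t‖ₑ * ‖ψ (x - t)‖ₑ ^ 2 := lintegral_mono hpt
    _ = (∫⁻ t, ‖f t‖ₑ) * ∫⁻ t, ∫⁻ x, ‖f t‖ₑ * ‖ψ (x - t)‖ₑ ^ 2 := by
        rw [lintegral_const_mul _ hm.lintegral_prod_right', lintegral_lintegral_swap hm.aemeasurable]
    _ = _ := by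
        have : ∀ t, ∫⁻ x, ‖f t‖ₑ * ‖ψ (x - t)‖ₑ ^ 2 = ‖f t‖ₑ * ∫⁻ x, ‖ψ x‖ₑ ^ 2 := fun t => by
          have hψt : Measurable fun x => ‖ψ (x - t)‖ₑ ^ 2 :=
            (hψ.comp (measurable_id.sub_const t)).enorm.pow_const 2
          rw [lintegral_const_mul _ hψt,
            lintegral_sub_right_eq_self (fun x => ‖ψ x‖ₑ ^ 2) t]
        simp only [this]
        rw [lintegral_mul_const _ hfe, sq, mul_assoc]

/-- Young's inequality `‖f * ψ‖₂ ≤ ‖f‖₁ ‖ψ‖₂`. -/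
theorem eLpNorm_conv_sq_le {f ψ : Rd d → ℂ} (hf : AEStronglyMeasurable f volume)
    (hψ : AEStronglyMeasurable ψ volume) :
    eLpNorm (conv f ψ) 2 volume ^ 2 ≤ eLpNorm f 1 volume ^ 2 * eLpNorm ψ 2 volume ^ 2 := by
  rw [conv_congr hf.ae_eq_mk hψ.ae_eq_mk, eLpNorm_congr_ae hf.ae_eq_mk,
    eLpNorm_congr_ae hψ.ae_eq_mk]
  exact eLpNorm_conv_sq_le_of_measurable hf.stronglyMeasurable_mk.measurable
    hψ.stronglyMeasurable_mk.measurable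

theorem sigmaMin_nonneg (A : GL (Fin d) ℝ) : 0 ≤ sigmaMin A :=
  LinearMap.singularValues_nonneg _ _

theorem det_toEuclideanLin (A : Matrix (Fin d) (Fin d) ℝ) :
    LinearMap.det (Matrix.toEuclideanLin A) = A.det := by
  simp [Matrix.toEuclideanLin, LinearMap.det_toLpLin]

/-- |det A| is the product of the d singular values, each at least the last one. -/
theorem sigmaMin_pow_le_abs_det (A : GL (Fin d) ℝ) :
    sigmaMin A ^ d ≤ |(A : Matrix (Fin d) (Fin d) ℝ).det| := by
  rw [← det_toEuclideanLin, ← LinearMap.normDet_eq_abs_det,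
    LinearMap.normDet_eq_prod_singularValues, finrank_euclideanSpace_fin]
  calc sigmaMin A ^ d = ∏ _i ∈ Finset.range d, sigmaMin A := by simp
    _ ≤ _ := Finset.prod_le_prod (fun _ _ => sigmaMin_nonneg A) fun i hi =>
      LinearMap.singularValues_antitone _ (by have := Finset.mem_range.1 hi; omega)

theorem tendsto_abs_det (hd : 1 ≤ d) {α : Type*} {l : Filter α} {A : α → GL (Fin d) ℝ}
    (hA : Tendsto (fun m => sigmaMin (A m)) l atTop) :
    Tendsto (fun m => |(A m : Matrix (Fin d) (Fin d) ℝ).det|) l atTop :=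
  tendsto_atTop_mono (fun m => sigmaMin_pow_le_abs_det (A m))
    ((tendsto_pow_atTop (by omega)).comp hA)

theorem det_coe_ne_zero (A : GL (Fin d) ℝ) : (A : Matrix (Fin d) (Fin d) ℝ).det ≠ 0 :=
  (Matrix.isUnit_iff_isUnit_det _).1 A.isUnit |>.ne_zero

theorem continuous_toEuclideanLin (A : Matrix (Fin d) (Fin d) ℝ) :
    Continuous (Matrix.toEuclideanLin A) :=
  LinearMap.continuous_of_finiteDimensional _

theorem lintegral_comp_toEuclideanLin (A : GL (Fin d) ℝ) {G : Rd d → ℝ≥0∞} (hG : Measurable G) :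
    ∫⁻ x, G (Matrix.toEuclideanLin (A : Matrix (Fin d) (Fin d) ℝ) x)
      = ENNReal.ofReal |(A : Matrix (Fin d) (Fin d) ℝ).det|⁻¹ * ∫⁻ x, G x := by
  rw [← lintegral_map hG (continuous_toEuclideanLin _).measurable,
    Measure.map_linearMap_addHaar_eq_smul_addHaar volume
      (by rw [det_toEuclideanLin]; exact det_coe_ne_zero A), det_toEuclideanLin,
    lintegral_smul_measure, abs_inv, smul_eq_mul]

theorem measurable_dilation (A : GL (Fin d) ℝ) {f : Rd d → ℂ} (hf : Measurable f) :
    Measurable (dilation A f) :=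
  (hf.comp (continuous_toEuclideanLin _).measurable).const_mul _

theorem enorm_dilation (A : GL (Fin d) ℝ) (f : Rd d → ℂ) (x : Rd d) :
    ‖dilation A f x‖ₑ = ENNReal.ofReal √|(A : Matrix (Fin d) (Fin d) ℝ).det|
      * ‖f (Matrix.toEuclideanLin (A : Matrix (Fin d) (Fin d) ℝ) x)‖ₑ := by
  rw [dilation, enorm_mul, ← ofReal_norm, Complex.norm_real,
    Real.norm_of_nonneg (Real.sqrt_nonneg _)]

theorem eLpNorm_dilation_two (A : GL (Fin d) ℝ) {f : Rd d → ℂ} (hf : Measurable f) :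
    eLpNorm (dilation A f) 2 volume = eLpNorm f 2 volume := by
  have hdet := abs_pos.2 (det_coe_ne_zero A)
  refine (ENNReal.pow_right_strictMono two_ne_zero).injective ?_
  simp only [eLpNorm_two_sq, enorm_dilation, mul_pow]
  have hfA : Measurable fun x =>
      ‖f (Matrix.toEuclideanLin (A : Matrix (Fin d) (Fin d) ℝ) x)‖ₑ ^ 2 :=
    (hf.comp (continuous_toEuclideanLin _).measurable).enorm.pow_const 2
  rw [lintegral_const_mul _ hfA, lintegral_comp_toEuclideanLin A (G := fun x => ‖f x‖ₑ ^ 2) (hf.enorm.pow_const 2), ← mul_assoc,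
    ← ENNReal.ofReal_pow (Real.sqrt_nonneg _), Real.sq_sqrt hdet.le,
    ← ENNReal.ofReal_mul hdet.le, mul_inv_cancel₀ hdet.ne', ENNReal.ofReal_one, one_mul]

theorem eLpNorm_dilation_one (A : GL (Fin d) ℝ) {f : Rd d → ℂ} (hf : Measurable f) :
    eLpNorm (dilation A f) 1 volume
      = ENNReal.ofReal (√|(A : Matrix (Fin d) (Fin d) ℝ).det|)⁻¹ * eLpNorm f 1 volume := by
  have hdet := abs_pos.2 (det_coe_ne_zero A)
  simp only [eLpNorm_one_eq_lintegral_enorm, enorm_dilation]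
  have hfA : Measurable fun x =>
      ‖f (Matrix.toEuclideanLin (A : Matrix (Fin d) (Fin d) ℝ) x)‖ₑ :=
    (hf.comp (continuous_toEuclideanLin _).measurable).enorm
  rw [lintegral_const_mul _ hfA, lintegral_comp_toEuclideanLin A (G := fun x => ‖f x‖ₑ) hf.enorm, ← mul_assoc,
    ← ENNReal.ofReal_mul (Real.sqrt_nonneg _)]
  congr 2
  rw [← div_eq_mul_inv, Real.sqrt_div_self]

theorem memLp_dilation (A : GL (Fin d) ℝ) (f : L2 d) : MemLp (dilation A f) 2 volume :=
  ⟨(measurable_dilation A (Lp.stronglyMeasurable f).measurable).aestronglyMeasurable, by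
    rw [eLpNorm_dilation_two A (Lp.stronglyMeasurable f).measurable]; exact (Lp.memLp f).2⟩

theorem exists_memLp_one_norm_eq_one (d : ℕ) :
    ∃ f : L2 d, ‖f‖ = 1 ∧ MemLp f 1 volume := by
  have hpos : 0 < volume (Metric.ball (0 : Rd d) 1) := Metric.measure_ball_pos _ _ one_pos
  have hfin : volume (Metric.ball (0 : Rd d) 1) ≠ ∞ := measure_ball_lt_top.ne
  set u : L2 d := indicatorConstLp 2 measurableSet_ball hfin (1 : ℂ) with hu
  have hu0 : ‖u‖ ≠ 0 := by
    rw [hu, norm_indicatorConstLp two_ne_zero ENNReal.ofNat_ne_top]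
    have := ENNReal.toReal_pos hpos.ne' hfin
    simp only [norm_one, one_mul]
    exact (Real.rpow_pos_of_pos this _).ne'
  refine ⟨‖u‖⁻¹ • u, ?_, ?_⟩
  · rw [norm_smul, norm_inv, norm_norm, inv_mul_cancel₀ hu0]
  · have h1 : MemLp u 1 volume := by
      refine MemLp.ae_eq indicatorConstLp_coeFn.symm ?_
      exact memLp_indicator_const 1 measurableSet_ball 1 (Or.inr hfin)
    exact (h1.const_smul ‖u‖⁻¹).ae_eq (Lp.coeFn_smul _ _).symm

/-! ### The filter bank as a propagator family, and its action on dilates. -/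

namespace IsScatteringFilterBank

variable {χ : Rd d → ℂ} {ψ : ι → Rd d → ℂ}

theorem enorm_convLM (hF : IsScatteringFilterBank χ ψ) (i : ι) (f : L2 d) :
    ‖hF.convLM i f‖ₑ = eLpNorm (conv f (ψ i)) 2 volume :=
  Lp.enorm_toLp (hF.memLp_conv i f)

/-- The difference bound is the pointwise reverse triangle inequality for the modulus. -/
theorem isPropagatorFamily (hF : IsScatteringFilterBank χ ψ) :
    IsPropagatorFamily hF.convLM hF.propagator where
  tsum_le f := by
    rw [Lp.enorm_def]
    simp only [enorm_convLM]
    exact hF.tsum_eLpNorm_conv_le f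
  map_smul i c hc f := by
    unfold propagator
    rw [← MemLp.toLp_const_smul]
    congr 1
    ext x
    rw [stepPropagator, conv_congr (Lp.coeFn_smul c f) EventuallyEq.rfl, conv_smul]
    simp [stepPropagator, abs_of_nonneg hc]
  enorm_sub_le i f h := by
    unfold propagator
    rw [← MemLp.toLp_sub, enorm_convLM, Lp.enorm_toLp,
      conv_congr (Lp.coeFn_sub f h) EventuallyEq.rfl, sub_eq_add_neg (f : Rd d → ℂ),
      conv_add (Lp.memLp f) (Lp.memLp h).neg (hF.highPass_memL2 i),
      show -(h : Rd d → ℂ) = (-1 : ℝ) • (h : Rd d → ℂ) by simp, conv_smul]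
    refine eLpNorm_mono fun x => ?_
    simp only [stepPropagator, Pi.sub_apply, Pi.add_apply, neg_smul, one_smul,
      ← Complex.ofReal_sub, Complex.norm_real]
    exact abs_norm_sub_norm_le _ _

theorem energyRemainder_eq_iterEnergy (hF : IsScatteringFilterBank χ ψ) (k : ℕ)
    (f : L2 d) : energyRemainder ψ k f = iterEnergy hF.propagator k f := by
  induction k generalizing f with
  | zero => simp [energyRemainder, scatteringPropagator, iterEnergy, Lp.enorm_def]
  | succ k ih =>
    rw [energyRemainder_succ, iterEnergy]
    refine tsum_congr fun i => ?_
    rw [← ih]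
    exact energyRemainder_congr ψ k (MemLp.coeFn_toLp (hF.memLp_stepPropagator i f)).symm

end IsScatteringFilterBank

/-- The dilation as an operator on `L²(ℝᵈ)`. -/
noncomputable def dilationLp (A : GL (Fin d) ℝ) (f : L2 d) : L2 d :=
  (memLp_dilation A f).toLp

theorem coeFn_dilationLp (A : GL (Fin d) ℝ) (f : L2 d) :
    dilationLp A f =ᵐ[volume] dilation A f :=
  MemLp.coeFn_toLp _

theorem norm_dilationLp (A : GL (Fin d) ℝ) (f : L2 d) : ‖dilationLp A f‖ = ‖f‖ := by
  rw [dilationLp, Lp.norm_toLp, eLpNorm_dilation_two A (Lp.stronglyMeasurable f).measurable,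
    Lp.norm_def]

theorem IsScatteringFilterBank.tendsto_convLM_dilationLp {χ : Rd d → ℂ} {ψ : ι → Rd d → ℂ}
    (hF : IsScatteringFilterBank χ ψ) (hd : 1 ≤ d) {α : Type*} {l : Filter α}
    {A : α → GL (Fin d) ℝ} (hA : Tendsto (fun m => sigmaMin (A m)) l atTop) {f : L2 d}
    (hf : MemLp f 1 volume) (i : ι) :
    Tendsto (fun m => hF.convLM i (dilationLp (A m) f)) l (𝓝 0) := by
  have hdet : Tendsto
      (fun m => ENNReal.ofReal (√|(A m : Matrix (Fin d) (Fin d) ℝ).det|)⁻¹) l (𝓝 0) := by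
    have := ENNReal.tendsto_ofReal (tendsto_inv_atTop_zero.comp
      (Real.tendsto_sqrt_atTop.comp (tendsto_abs_det hd hA)))
    simpa using this
  have hbound : ∀ m, ‖hF.convLM i (dilationLp (A m) f)‖ₑ
      ≤ ENNReal.ofReal (√|(A m : Matrix (Fin d) (Fin d) ℝ).det|)⁻¹ * eLpNorm f 1 volume
        * eLpNorm (ψ i) 2 volume := by
    intro m
    have h := eLpNorm_conv_sq_le (memLp_dilation (A m) f).1 (hF.highPass_memL2 i).1
    rw [eLpNorm_dilation_one _ (Lp.stronglyMeasurable f).measurable, ← mul_pow] at h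
    rw [hF.enorm_convLM, conv_congr (coeFn_dilationLp (A m) f) EventuallyEq.rfl]
    exact (ENNReal.pow_right_strictMono two_ne_zero).le_iff_le.1 h
  rw [tendsto_zero_iff_enorm_tendsto_zero]
  refine tendsto_of_tendsto_of_tendsto_of_le_of_le tendsto_const_nhds ?_
    (fun _ => zero_le) hbound
  have h1 := ENNReal.Tendsto.mul_const hdet (Or.inr hf.2.ne)
  have h2 := ENNReal.Tendsto.mul_const h1 (Or.inr (hF.highPass_memL2 i).2.ne)
  simpa using h2

/-! ### Slowly decaying vectors, density and meagreness. -/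

section Density

variable {χ : Rd d → ℂ} {ψ : ι → Rd d → ℂ} {A : ℕ+ → GL (Fin d) ℝ}

theorem dilationEnergyBound_le_limsup {f : L2 d} (hf : ‖f‖ = 1) (k : ℕ+) :
    dilationEnergyBound ψ A
      ≤ limsup (fun m : ℕ+ => energyRemainder ψ k (dilation (A m) f)) atTop := by
  unfold dilationEnergyBound
  exact (iInf_le _ (⟨f, hf⟩ : {f : L2 d // ‖f‖ = 1})).trans (iInf_le _ k)

/-- Finiteness of δ is what makes δ / 2 < δ strict, so that the limsup exceeds δ / 2 infinitely
often. -/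
theorem dilationEnergyBound_le_one (hF : IsScatteringFilterBank χ ψ) :
    dilationEnergyBound ψ A ≤ 1 := by
  obtain ⟨f, hf, -⟩ := exists_memLp_one_norm_eq_one d
  refine (dilationEnergyBound_le_limsup hf 1).trans ?_
  refine limsup_le_of_le (h := Eventually.of_forall fun m => ?_)
  rw [← energyRemainder_congr _ _ (coeFn_dilationLp (A m) f), hF.energyRemainder_eq_iterEnergy]
  refine (hF.isPropagatorFamily.iterEnergy_le _ _).trans_eq ?_
  rw [← ofReal_norm, norm_dilationLp, hf]
  simp

theorem frequently_le_toReal_iterEnergy (hF : IsScatteringFilterBank χ ψ)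
    (hδ : 0 < dilationEnergyBound ψ A) {f : L2 d} (hf : ‖f‖ = 1) (k : ℕ+) :
    ∃ᶠ m in atTop, (dilationEnergyBound ψ A).toReal / 2
      ≤ (iterEnergy hF.propagator k (dilationLp (A m) f)).toReal := by
  have hfin : dilationEnergyBound ψ A ≠ ∞ :=
    ne_top_of_le_ne_top ENNReal.one_ne_top (dilationEnergyBound_le_one hF)
  have hlt : dilationEnergyBound ψ A / 2
      < limsup (fun m : ℕ+ => energyRemainder ψ k (dilation (A m) f)) atTop :=
    (ENNReal.half_lt_self hδ.ne' hfin).trans_le (dilationEnergyBound_le_limsup hf k)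
  refine (frequently_lt_of_lt_limsup (h := hlt)).mono fun m hm => ?_
  rw [← energyRemainder_congr _ _ (coeFn_dilationLp (A m) f),
    hF.energyRemainder_eq_iterEnergy] at hm
  simpa using ENNReal.toReal_mono (hF.isPropagatorFamily.iterEnergy_ne_top _ _) hm.le

theorem exists_slow_energyRemainder (hd : 1 ≤ d) (hF : IsScatteringFilterBank χ ψ)
    (hA : Tendsto (fun m => sigmaMin (A m)) atTop atTop) (hδ : 0 < dilationEnergyBound ψ A)
    (g : L2 d) {E : ℕ+ → ℝ} (hE : IsNonincreasingNullSeq E) :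
    ∃ f : L2 d, ‖f - g‖ ^ 2 ≤ 4 * ‖g‖ ^ 2 * E 1 ∧
      ∀ N : ℕ+, ENNReal.ofReal (‖g‖ ^ 2 / 8) * dilationEnergyBound ψ A * ENNReal.ofReal (E N)
        ≤ energyRemainder ψ N f := by
  have hfin : dilationEnergyBound ψ A ≠ ∞ :=
    ne_top_of_le_ne_top ENNReal.one_ne_top (dilationEnergyBound_le_one hF)
  obtain ⟨u, hu, hu1⟩ := exists_memLp_one_norm_eq_one d
  obtain ⟨f, hfg, hf⟩ := hF.isPropagatorFamily.exists_slow_decay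
    (hF.tendsto_convLM_dilationLp hd hA hu1)
    (fun m => (norm_dilationLp (A m) u).trans_le hu.le)
    (half_pos (ENNReal.toReal_pos hδ.ne' hfin)) (frequently_le_toReal_iterEnergy hF hδ hu) g hE
  refine ⟨f, hfg, fun N => ?_⟩
  rw [hF.energyRemainder_eq_iterEnergy, ← ENNReal.ofReal_toReal hfin,
    ← ENNReal.ofReal_mul (by positivity), ← ENNReal.ofReal_mul (by positivity)]
  -- With δ / 2 as threshold, the construction yields the factor ‖g‖² δ / 4, twice what is needed.
  refine ENNReal.ofReal_le_of_le_toReal (le_trans ?_ (hf N))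
  have := (hE.pos N).le
  have : 0 ≤ ‖g‖ ^ 2 * (dilationEnergyBound ψ A).toReal * E N := by positivity
  linarith

theorem IsNonincreasingNullSeq.const_mul_sqrt {E : ℕ+ → ℝ} (hE : IsNonincreasingNullSeq E) {s : ℝ}
    (hs : 0 < s) : IsNonincreasingNullSeq fun N => s * √(E N) where
  pos N := mul_pos hs (Real.sqrt_pos.2 (hE.pos N))
  antitone _ _ h := mul_le_mul_of_nonneg_left (Real.sqrt_le_sqrt (hE.antitone h)) hs.le
  tendsto_zero := by
    simpa using ((Real.continuous_sqrt.tendsto 0).comp hE.tendsto_zero).const_mul s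

theorem dense_compl_decaySet (hd : 1 ≤ d) (hF : IsScatteringFilterBank χ ψ)
    (hA : Tendsto (fun m => sigmaMin (A m)) atTop atTop) (hδ : 0 < dilationEnergyBound ψ A)
    {E : ℕ+ → ℝ} (hE : IsNonincreasingNullSeq E) : Dense (decaySet ψ E)ᶜ := by
  obtain ⟨u, hu, -⟩ := exists_memLp_one_norm_eq_one d
  have : Nontrivial (L2 d) := ⟨u, 0, by rintro rfl; simp at hu⟩
  -- At g = 0 the lower bound is vacuous; it suffices to approximate nonzero vectors, which are
  -- dense.
  have hsub : ({0} : Set (L2 d))ᶜ ⊆ closure (decaySet ψ E)ᶜ := by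
    intro g hg
    have hgpos : 0 < ‖g‖ := norm_pos_iff.2 hg
    have hδpos : 0 < (dilationEnergyBound ψ A).toReal := ENNReal.toReal_pos hδ.ne'
      (ne_top_of_le_ne_top ENNReal.one_ne_top (dilationEnergyBound_le_one hF))
    refine Metric.mem_closure_iff.2 fun r hr => ?_
    have hE1 := Real.sqrt_pos.2 (hE.pos 1)
    -- Chosen so that the distance bound 4 ‖g‖² s √(E_1) equals r² / 2. The decay rate s √E_N is not
    -- O(E_N), because E_N / √E_N → 0.
    set s : ℝ := r ^ 2 / (8 * ‖g‖ ^ 2 * √(E 1)) with hs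
    have hspos : 0 < s := by positivity
    obtain ⟨f, hfg, hf⟩ :=
      exists_slow_energyRemainder hd hF hA hδ g (hE.const_mul_sqrt hspos)
    refine ⟨f, ?_, ?_⟩
    · rintro ⟨C, hC, N₀, hN⟩
      set c : ℝ := ‖g‖ ^ 2 / 8 * (dilationEnergyBound ψ A).toReal * s with hc
      have hcpos : 0 < c := by positivity
      have hle : ∀ N, N₀ ≤ N → c ≤ C * √(E N) := by
        intro N hNN
        have h1 := (hf N).trans (hN N hNN)
        rw [← ENNReal.ofReal_toReal (ne_top_of_le_ne_top ENNReal.one_ne_top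
            (dilationEnergyBound_le_one (A := A) hF)), ← ENNReal.ofReal_mul (by positivity),
          ← ENNReal.ofReal_mul (by positivity),
          ENNReal.ofReal_le_ofReal_iff (mul_nonneg hC.le (hE.pos N).le)] at h1
        have hq := Real.sqrt_pos.2 (hE.pos N)
        refine le_of_mul_le_mul_right ?_ hq
        rw [mul_assoc C, Real.mul_self_sqrt (hE.pos N).le, hc]
        linarith
      have hlim : Tendsto (fun N => C * √(E N)) atTop (𝓝 0) := (hE.const_mul_sqrt hC).tendsto_zero
      exact not_le.2 hcpos (ge_of_tendsto hlim ((eventually_ge_atTop N₀).mono hle))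
    · rw [dist_comm, dist_eq_norm]
      refine lt_of_pow_lt_pow_left₀ 2 hr.le (hfg.trans_lt ?_)
      have : 4 * ‖g‖ ^ 2 * (s * √(E 1)) = r ^ 2 / 2 := by
        rw [hs]
        field_simp
        norm_num
      rw [this]
      exact half_lt_self (by positivity)
  exact dense_closure.1 ((dense_compl_singleton (0 : L2 d)).mono hsub)

theorem isMeagre_decaySet (hF : IsScatteringFilterBank χ ψ) {E : ℕ+ → ℝ}
    (hE : IsNonincreasingNullSeq E) (hdense : Dense (decaySet ψ E)ᶜ) :
    IsMeagre (decaySet ψ E) := by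
  let S : ℕ × ℕ+ → Set (L2 d) := fun q => {f | ∀ N : ℕ+, q.2 ≤ N →
    (iterEnergy hF.propagator N f).toReal ≤ (q.1 + 1) * E N}
  have hiff : ∀ (f : L2 d) (N : ℕ+) (C : ℝ), 0 ≤ C → (energyRemainder ψ N f
      ≤ ENNReal.ofReal (C * E N) ↔ (iterEnergy hF.propagator N f).toReal ≤ C * E N) := by
    intro f N C hC
    rw [hF.energyRemainder_eq_iterEnergy, ENNReal.le_ofReal_iff_toReal_le
      (hF.isPropagatorFamily.iterEnergy_ne_top _ _) (mul_nonneg hC (hE.pos N).le)]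
  have hsub : ∀ q, S q ⊆ decaySet ψ E := fun q f hf =>
    ⟨q.1 + 1, by positivity, q.2, fun N hN => (hiff f N _ (by positivity)).2 (hf N hN)⟩
  have hclosed : ∀ q, IsClosed (S q) := fun q => by
    simp only [S, Set.ofPred_forall]
    exact isClosed_iInter fun N => isClosed_iInter fun _ =>
      isClosed_le (hF.isPropagatorFamily.continuous_toReal_iterEnergy N) continuous_const
  have hcover : decaySet ψ E ⊆ ⋃ q, S q := by
    rintro f ⟨C, hC, N₀, hN⟩
    refine Set.mem_iUnion.2 ⟨(⌈C⌉₊, N₀), fun N hNN => ?_⟩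
    refine ((hiff f N C hC.le).1 (hN N hNN)).trans ?_
    have := Nat.le_ceil C
    exact mul_le_mul_of_nonneg_right (this.trans (by simp)) (hE.pos N).le
  refine IsMeagre.mono hcover (isMeagre_iUnion fun q => ?_)
  refine ((hclosed q).isNowhereDense_iff.2 ?_).isMeagre
  -- Each closed piece lies in `decaySet`, whose interior is empty because its complement is dense.
  rw [← Set.subset_empty_iff, ← interior_eq_empty_iff_dense_compl.2 hdense]
  exact interior_mono (hsub q)

end Density

end Scattering

theorem mainTheorem4 (d : ℕ) (hd : 1 ≤ d) {ι : Type*} [Countable ι] [Infinite ι]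
    (χ : Rd d → ℂ) (ψ : ι → Rd d → ℂ) (hF : IsScatteringFilterBank χ ψ)
    (A : ℕ+ → GL (Fin d) ℝ) (hA : Tendsto (fun m => sigmaMin (A m)) atTop atTop)
    (hδ : 0 < dilationEnergyBound ψ A) :
    (∀ g : L2 d, ∃ C : ℝ, 0 < C ∧ ∀ E : ℕ+ → ℝ, IsNonincreasingNullSeq E →
      ∃ f : L2 d,
        ‖f‖ ^ 2 ≤ C * (1 + E 1) ∧
        ‖f - g‖ ^ 2 ≤ C * E 1 ∧
        ∀ N : ℕ+, ENNReal.ofReal (‖g‖ ^ 2 / 8) * dilationEnergyBound ψ A * ENNReal.ofReal (E N)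
          ≤ energyRemainder ψ N f) ∧
    (∀ E : ℕ+ → ℝ, IsNonincreasingNullSeq E →
      IsMeagre (decaySet ψ E) ∧ Dense (decaySet ψ E)ᶜ) := by
  -- ‖f‖² ≤ 2‖g‖² + 2‖f - g‖² ≤ 2‖g‖² + 8‖g‖² E_1; the summand 1 keeps the constant positive when g
  -- = 0.
  refine ⟨fun g => ⟨8 * ‖g‖ ^ 2 + 1, by positivity, fun E hE => ?_⟩, fun E hE => ?_⟩
  · obtain ⟨f, hfg, hf⟩ := exists_slow_energyRemainder hd hF hA hδ g hE
    have hE1 := hE.pos 1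
    have hgE : 0 ≤ ‖g‖ ^ 2 * E 1 := by positivity
    refine ⟨f, ?_, by linarith, hf⟩
    have h1 : ‖f‖ ≤ ‖g‖ + ‖f - g‖ := by simpa using norm_add_le g (f - g)
    have h2 := pow_le_pow_left₀ (norm_nonneg f) h1 2
    nlinarith [sq_nonneg (‖g‖ - ‖f - g‖), sq_nonneg ‖g‖]
  · have hdense := dense_compl_decaySet hd hF hA hδ hE
    exact ⟨isMeagre_decaySet hF hE hdense, hdense⟩
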